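/- Fix finite action sets $A$ (Alice) and $B$ (Bob). A repeated game is given by a payoff matrix $G: A\times B\to[0,1]$ (Alice's payoffs), played at every stage $n=1,2,\dots$. Let $\mathcal H=\bigcup_{n\ge 0}(A\times B)^n$ be the set of finite histories. A strategy of Alice (resp. Bob) is a map $\pi:\mathcal H\to\Delta(A)$ (resp. $\phi:\mathcal H\to\Delta(B)$) into probability distributions; after each history the two players draw their actions independently from these distributions. For a history $h\in\mathcal H$ (possibly of probability zero) put $$V_G(\pi,\phi\mid h)=\liminf_{s\to\infty}\ \mathbb E_{\pi,\phi}\Big[\tfrac1s\sum_{n=|h|+1}^{|h|+s}G(a_n,b_n)\ \Big|\ h\Big],$$ where play is continued from $h$ according to $\pi$ and $\phi$, and let $V_G(\pi,\phi)=V_G(\pi,\phi\mid\emptyset)$. For a finite nonempty set $E$ of strategies of Alice (experts), the adaptive regret of $\pi$ against $\phi$ is $\mathcal R^{\mathrm{adapt}}_{G,E}(\pi,\phi)=\max_{e\in E}V_G(e,\phi)-V_G(\pi,\phi)$. Bob's strategy $\phi$ is open-ended with respect to $E$ in $G$ if for every $e\in E$ there is a constant $\mu_e$ with $V_G(e,\phi\mid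 h)=\mu_e$ for all $h\in\mathcal H$. A learning algorithm $\mathcal A$ is a map that assigns to a game $G$ and a set of experts $E$ a strategy $\mathcal A_{G,E}$ of Alice. **Theorem.** For every $N\ge 3$ there are an $N\times N$ repeated game $G$ and a finite set $E$ of experts, namely the coordination game $A=B=\{1,\dots,N\}$, $G(a,b)=1$ if $a=b$ and $G(a,b)=0$ otherwise, and the $N$ experts that each play one fixed action at all stages, such that for every learning algorithm $\mathcal A$ and every $0<\delta<\frac{N-2}{N}$ there is a strategy $\phi$ of Bob with $$\mathcal R^{\mathrm{adapt}}_{G,E}(\mathcal A_{G,E},\phi)\ \ge\ \frac12\Big[\frac{N-2}{N}-\delta\Big]^2$$ such that $\phi$ is open-ended with respect to $E$ in $G$. -/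

import Mathlib

open Filter

noncomputable section

/-- The stage game of an infinitely repeated matrix game with action sets `A` (Alice) and `B` (Bob):
Alice's payoff matrix, with entries in `[0, 1]`. -/
structure RepeatedGame (A B : Type*) where
  payoff : A → B → ℝ
  payoff_nonneg : ∀ a b, 0 ≤ payoff a b
  payoff_le_one : ∀ a b, payoff a b ≤ 1

/-- Finite histories of play. The most recent stage is the head of the list. -/
abbrev History (A B : Type*) := List (A × B)

/-- Behavioral strategies of Alice, defined on all finite histories. -/
abbrev AliceStrategy (A B : Type*) := History A B → PMF A

/-- Behavioral strategies of Bob, defined on all finite histories. -/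
abbrev BobStrategy (A B : Type*) := History A B → PMF B

/-- A learning algorithm for Alice: knowing the game and a set of experts, it returns the
strategy that she follows. -/
abbrev LearningAlgorithm (A B : Type*) :=
  RepeatedGame A B → Set (AliceStrategy A B) → AliceStrategy A B

variable {A B : Type*}

/-- The law of the pair of actions taken in the stage that follows history `h`: the players
randomize independently. -/
def stageLaw (π : AliceStrategy A B) (φ : BobStrategy A B) (h : History A B) : PMF (A × B) :=
  (π h).bind fun a => (φ h).map fun b => (a, b)

/-- The law of the history reached when, starting from history `h` (which may be one of
probability zero), `s` further stages are played according to `π` and `φ`. -/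
def playLaw (π : AliceStrategy A B) (φ : BobStrategy A B) (h : History A B) :
    ℕ → PMF (History A B)
  | 0 => PMF.pure h
  | s + 1 => (playLaw π φ h s).bind fun h' => (stageLaw π φ h').map fun p => p :: h'

/-- Alice's average payoff over the last `s` stages of a history. -/
def averagePayoff (G : RepeatedGame A B) (s : ℕ) (h : History A B) : ℝ :=
  (1 / (s : ℝ)) * ((h.take s).map fun p => G.payoff p.1 p.2).sum

/-- Alice's expected average payoff over the `s` stages that follow history `h`. -/
def expectedAveragePayoff (G : RepeatedGame A B) (π : AliceStrategy A B) (φ : BobStrategy A B)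
    (h : History A B) (s : ℕ) : ℝ :=
  ∑' h' : History A B, (playLaw π φ h s h').toReal * averagePayoff G s h'

/-- `V_G(π, φ | h)`: the lower limit of Alice's expected average payoff after history `h`. -/
def value (G : RepeatedGame A B) (π : AliceStrategy A B) (φ : BobStrategy A B)
    (h : History A B) : ℝ :=
  liminf (fun s : ℕ => expectedAveragePayoff G π φ h s) atTop

/-- Adaptive regret of `π` against `φ` with respect to the experts `E`
(for a finite nonempty `E` the supremum is a maximum). -/
def adaptiveRegret (G : RepeatedGame A B) (E : Set (AliceStrategy A B)) (π : AliceStrategy A B)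
    (φ : BobStrategy A B) : ℝ :=
  sSup ((fun e => value G e φ []) '' E) - value G π φ []

/-- Bob's strategy is open-ended with respect to the experts `E`. -/
def IsOpenEnded (G : RepeatedGame A B) (E : Set (AliceStrategy A B)) (φ : BobStrategy A B) :
    Prop :=
  ∀ e ∈ E, ∃ μ : ℝ, ∀ h : History A B, value G e φ h = μ

/-- The expert that takes action `a` at every stage. -/
def fixedAction (a : A) : AliceStrategy A B := fun _ => PMF.pure a

/-- The set of all fixed-action experts. -/
def fixedActionExperts (A B : Type*) : Set (AliceStrategy A B) := Set.range fixedAction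

/-- The `N × N` coordination game: payoff `1` if the actions agree and `0` otherwise. -/
def coordinationGame (N : ℕ) : RepeatedGame (Fin N) (Fin N) where
  payoff a b := if a = b then 1 else 0
  payoff_nonneg a b := by split_ifs <;> norm_num
  payoff_le_one a b := by split_ifs <;> norm_num

end

/-!
Bob plays uniformly at random, except that he rewards Alice by matching one particular action `a`
while she is on a sufficiently long run of `a` (`triggerStrategy`). A run that started at stage
`m` counts as long once it has lasted `T m` stages. After any history, repeating `a` forever
eventually earns `1` per stage, and repeating any other action leaves Bob uniform from the second
stage on and earns `1 / N` per stage. Hence Bob is open-ended, and the best expert has value `1`.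

The action `a` and the thresholds `T` depend on Alice's strategy `π`. Against uniform play, the
events "Alice eventually plays `a` forever" are disjoint for different `a`, so one of them has
probability at most `1 / N` (`exists_action_rarely_constSince`). For this `a`, the probability that
a run from stage `m` survives `T m` stages is as close as desired to the probability that it
survives forever. If the differences sum to a small number, then with probability close to
`1 / N` at most does Alice ever complete a long run (`exists_thresholds`). Until she does, Bob's
play is uniform, so the probability that she ever does is the same against Bob's actual strategy
(`step_pow_eq_of_agree`). She therefore earns at most `1 / N` per stage plus `1 / N + δ` for the
event of a long run (`value_trigger_le`). Her regret is at least `(N - 2) / N - δ`, which lies in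
`[0, 1]` and so exceeds half of its square.

Infinite plays are avoided: probabilities after `n` stages are the `n`-th powers of a one-stage
transition operator `step` on functions of histories, and "forever" is the limit of the
decreasing probabilities that a run has survived until stage `n`.
-/

/-! ### Expectations over finitely supported laws -/

/-- The expectation of a real function under a discrete law. -/
noncomputable def expectation {α : Type*} (p : PMF α) (f : α → ℝ) : ℝ :=
  ∑' x, (p x).toReal * f x

theorem expectation_eq_sum {α : Type*} {p : PMF α} {S : Finset α}
    (hS : p.support ⊆ S) (f : α → ℝ) :
    expectation p f = ∑ x ∈ S, (p x).toReal * f x := by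
  refine tsum_eq_sum fun x hx => ?_
  have : p x = 0 := by
    by_contra h
    exact hx (hS ((PMF.mem_support_iff p x).2 h))
  simp [this]

theorem expectation_pure {α : Type*} (x : α) (f : α → ℝ) :
    expectation (PMF.pure x) f = f x := by
  rw [expectation_eq_sum (S := {x}) (by simp)]
  simp

theorem expectation_bind {α β : Type*} {p : PMF α} {q : α → PMF β}
    (hp : p.support.Finite) (hq : ∀ x, (q x).support.Finite) (f : β → ℝ) :
    expectation (p.bind q) f = expectation p fun x => expectation (q x) f := by
  classical
  set S := hp.toFinset with hS
  set U := S.biUnion fun x => (hq x).toFinset with hU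
  have hSp : p.support ⊆ S := by simp [hS]
  have hUq : ∀ x ∈ S, (q x).support ⊆ U := fun x hx y hy => by
    simp only [hU, Finset.coe_biUnion, Set.mem_iUnion]
    exact ⟨x, hx, by simpa using hy⟩
  have hbind : (p.bind q).support ⊆ U := by
    intro y hy
    rw [PMF.support_bind] at hy
    obtain ⟨x, hx, hy⟩ := Set.mem_iUnion₂.1 hy
    exact hUq x (hSp hx) hy
  have hval : ∀ y, ((p.bind q) y).toReal = ∑ x ∈ S, (p x).toReal * (q x y).toReal := by
    intro y
    rw [PMF.bind_apply, tsum_eq_sum (s := S), ENNReal.toReal_sum]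
    · simp
    · exact fun x _ => ENNReal.mul_ne_top (p.apply_ne_top x) ((q x).apply_ne_top y)
    · intro x hx
      have : p x = 0 := by
        by_contra h
        exact hx (hSp ((PMF.mem_support_iff p x).2 h))
      simp [this]
  rw [expectation_eq_sum hbind, expectation_eq_sum hSp]
  simp only [hval, Finset.sum_mul]
  rw [Finset.sum_comm]
  refine Finset.sum_congr rfl fun x hx => ?_
  rw [expectation_eq_sum (hUq x hx), Finset.mul_sum]
  exact Finset.sum_congr rfl fun y _ => by ring

theorem expectation_map {α β : Type*} {p : PMF α} (hp : p.support.Finite) (g : α → β)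
    (f : β → ℝ) : expectation (p.map g) f = expectation p fun x => f (g x) := by
  rw [PMF.map, expectation_bind hp fun x => by simp]
  simp [expectation_pure]

theorem sum_toReal_eq_one {α : Type*} [Fintype α] (p : PMF α) : ∑ x, (p x).toReal = 1 := by
  rw [← ENNReal.toReal_sum fun x _ => p.apply_ne_top x, ← tsum_fintype (L := .unconditional α),
    p.tsum_coe, ENNReal.toReal_one]

/-! ### The one-stage transition operator -/

section Transition

variable [Fintype A] [Fintype B]

/-- The transition operator of play: `step π φ f h` is the expectation of `f` at the history
reached from `h` after one stage. Its `n`-th power is the expectation after `n` stages. -/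
noncomputable def step (π : AliceStrategy A B) (φ : BobStrategy A B) :
    (History A B → ℝ) →ₗ[ℝ] (History A B → ℝ) where
  toFun f h := ∑ a, ∑ b, (π h a).toReal * (φ h b).toReal * f ((a, b) :: h)
  map_add' f g := by
    ext h
    simp [mul_add, Finset.sum_add_distrib]
  map_smul' c f := by
    ext h
    simp only [Pi.smul_apply, smul_eq_mul, RingHom.id_apply, Finset.mul_sum]
    exact Finset.sum_congr rfl fun a _ => Finset.sum_congr rfl fun b _ => by ring

variable {π : AliceStrategy A B} {φ ψ : BobStrategy A B}

theorem step_apply (f : History A B → ℝ) (h : History A B) :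
    step π φ f h = ∑ a, ∑ b, (π h a).toReal * (φ h b).toReal * f ((a, b) :: h) := rfl

theorem step_pow_succ (n : ℕ) (f : History A B → ℝ) :
    (step π φ ^ (n + 1)) f = (step π φ ^ n) (step π φ f) := by
  rw [pow_succ, Module.End.mul_apply]

theorem step_const_of_forall {f : History A B → ℝ} {h : History A B} {c : ℝ}
    (hf : ∀ a b, f ((a, b) :: h) = c) : step π φ f h = c := by
  simp only [step_apply, hf, mul_assoc, ← Finset.mul_sum, ← Finset.sum_mul, sum_toReal_eq_one,
    one_mul]

theorem step_mono {f g : History A B → ℝ} {h : History A B}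
    (hfg : ∀ a b, f ((a, b) :: h) ≤ g ((a, b) :: h)) : step π φ f h ≤ step π φ g h :=
  Finset.sum_le_sum fun a _ => Finset.sum_le_sum fun b _ =>
    mul_le_mul_of_nonneg_left (hfg a b) (by positivity)

theorem step_pow_mono {n : ℕ} {f g : History A B → ℝ} {h : History A B}
    (hfg : ∀ h', h'.length = h.length + n → f h' ≤ g h') :
    (step π φ ^ n) f h ≤ (step π φ ^ n) g h := by
  induction n generalizing f g with
  | zero => exact hfg h rfl
  | succ n ih =>
    rw [step_pow_succ, step_pow_succ]
    refine ih fun h' hh' => step_mono fun a b => hfg _ ?_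
    simp [hh', add_assoc]

theorem step_pow_congr {n : ℕ} {f g : History A B → ℝ} {h : History A B}
    (hfg : ∀ h', h'.length = h.length + n → f h' = g h') :
    (step π φ ^ n) f h = (step π φ ^ n) g h :=
  le_antisymm (step_pow_mono fun h' hh' => (hfg h' hh').le)
    (step_pow_mono fun h' hh' => (hfg h' hh').ge)

theorem step_pow_const (n : ℕ) (c : ℝ) (h : History A B) :
    (step π φ ^ n) (fun _ => c) h = c := by
  induction n with
  | zero => rfl
  | succ n ih =>
    rw [step_pow_succ]
    rwa [show step π φ (fun _ => c) = fun _ => c from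
      funext fun h' => step_const_of_forall fun _ _ => rfl]

/-- A function that vanishes on a set of histories closed under continuation has the same
expectation against two strategies of Bob that agree outside this set. -/
theorem step_pow_eq_of_agree {S : Set (History A B)} (hS : ∀ h ∈ S, ∀ p, p :: h ∈ S)
    (hφ : ∀ h ∉ S, φ h = ψ h) (n : ℕ) {f : History A B → ℝ} (hf : ∀ h ∈ S, f h = 0) :
    (step π φ ^ n) f = (step π ψ ^ n) f := by
  induction n generalizing f with
  | zero => rfl
  | succ n ih =>
    have hz : ∀ χ : BobStrategy A B, ∀ h ∈ S, step π χ f h = 0 := fun χ h hh =>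
      step_const_of_forall fun a b => hf _ (hS h hh _)
    have heq : step π φ f = step π ψ f := by
      ext h
      by_cases hh : h ∈ S
      · rw [hz φ h hh, hz ψ h hh]
      · rw [step_apply, step_apply, hφ h hh]
    rw [step_pow_succ, step_pow_succ, ← heq, ih (hz φ)]

/-- Against a fixed action of Alice, only the continuations in which she takes this action
contribute to the expectation. -/
theorem step_pow_fixedAction_eq {c : A} {v : ℝ} {n : ℕ} {f : History A B → ℝ} {h : History A B}
    (hf : ∀ l : History A B, l.length = n → (∀ p ∈ l, p.1 = c) → f (l ++ h) = v) :
    (step (fixedAction c) φ ^ n) f h = v := by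
  classical
  induction n generalizing f with
  | zero => exact hf [] rfl (by simp)
  | succ n ih =>
    rw [step_pow_succ]
    refine ih fun l hl hlc => ?_
    have h1 : ∀ b, f ((c, b) :: (l ++ h)) = v := fun b =>
      hf ((c, b) :: l) (by simp [hl]) (by simpa using hlc)
    rw [step_apply, Finset.sum_eq_single c]
    · simp [fixedAction, h1, ← Finset.sum_mul, sum_toReal_eq_one]
    · intro a _ hac
      simp [fixedAction, hac]
    · simp

theorem playLaw_support_finite (h : History A B) (n : ℕ) :
    (playLaw π φ h n).support.Finite := by
  induction n with
  | zero => simp [playLaw]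
  | succ n ih =>
    rw [playLaw, PMF.support_bind]
    refine ih.biUnion fun h' _ => ?_
    rw [PMF.support_map]
    exact (Set.toFinite _).image _

theorem expectation_playLaw (h : History A B) (n : ℕ) (f : History A B → ℝ) :
    expectation (playLaw π φ h n) f = (step π φ ^ n) f h := by
  induction n generalizing f with
  | zero => exact expectation_pure h f
  | succ n ih =>
    have hstage : ∀ h', expectation ((stageLaw π φ h').map fun p => p :: h') f
        = step π φ f h' := by
      intro h'
      rw [expectation_map (Set.toFinite _), stageLaw,
        expectation_bind (Set.toFinite _) fun a => Set.toFinite _]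
      simp only [expectation_map (Set.toFinite _)]
      simp only [expectation, tsum_fintype, step_apply, Finset.mul_sum, mul_assoc]
    rw [playLaw, expectation_bind (playLaw_support_finite h n) fun h' => by
      rw [PMF.support_map]; exact (Set.toFinite _).image _]
    simp only [hstage]
    rw [ih, step_pow_succ]

/-! ### Values as limits of averages of stage payoffs -/

/-- Alice's expected payoff in the stage that follows a history. -/
noncomputable def stagePayoff (G : RepeatedGame A B) (π : AliceStrategy A B)
    (φ : BobStrategy A B) (h : History A B) : ℝ :=
  ∑ a, ∑ b, (π h a).toReal * (φ h b).toReal * G.payoff a b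

variable {G : RepeatedGame A B}

theorem stagePayoff_nonneg (h : History A B) : 0 ≤ stagePayoff G π φ h :=
  Finset.sum_nonneg fun a _ => Finset.sum_nonneg fun b _ =>
    mul_nonneg (by positivity) (G.payoff_nonneg a b)

theorem stagePayoff_le_one (h : History A B) : stagePayoff G π φ h ≤ 1 := by
  calc stagePayoff G π φ h
      ≤ ∑ a, ∑ b, (π h a).toReal * (φ h b).toReal * 1 :=
        Finset.sum_le_sum fun a _ => Finset.sum_le_sum fun b _ =>
          mul_le_mul_of_nonneg_left (G.payoff_le_one a b) (by positivity)
    _ = 1 := step_const_of_forall (f := fun _ => 1) (h := h) fun _ _ => rfl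

theorem stagePayoff_fixedAction (c : A) (h : History A B) :
    stagePayoff G (fixedAction c) φ h = ∑ b, (φ h b).toReal * G.payoff c b := by
  classical
  rw [stagePayoff, Finset.sum_eq_single c]
  · simp [fixedAction]
  · intro a _ hac
    simp [fixedAction, hac]
  · simp

theorem step_pow_sum_take (h : History A B) (s : ℕ) :
    (step π φ ^ s) (fun h' => ((h'.take s).map fun p => G.payoff p.1 p.2).sum) h
      = ∑ k ∈ Finset.range s, (step π φ ^ k) (stagePayoff G π φ) h := by
  induction s with
  | zero => simp
  | succ s ih =>
    rw [step_pow_succ, Finset.sum_range_succ, ← ih, ← Pi.add_apply, ← map_add]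
    refine congrFun (congrArg _ (funext fun h' => ?_)) h
    simp only [step_apply, List.take_succ_cons, List.map_cons, List.sum_cons, mul_add,
      Finset.sum_add_distrib, Pi.add_apply, stagePayoff]
    rw [add_comm]
    congr 1
    simp only [mul_assoc, ← Finset.mul_sum, ← Finset.sum_mul, sum_toReal_eq_one, one_mul]

theorem expectedAveragePayoff_eq (h : History A B) (s : ℕ) :
    expectedAveragePayoff G π φ h s
      = (s : ℝ)⁻¹ * ∑ k ∈ Finset.range s, (step π φ ^ k) (stagePayoff G π φ) h := by
  rw [← step_pow_sum_take]
  calc expectedAveragePayoff G π φ h s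
      = (step π φ ^ s) (averagePayoff G s) h := expectation_playLaw h s _
    _ = (step π φ ^ s) ((s : ℝ)⁻¹ •
          fun h' => ((h'.take s).map fun p => G.payoff p.1 p.2).sum) h := by
        refine congrFun (congrArg _ (funext fun h' => ?_)) h
        simp [averagePayoff]
    _ = _ := by rw [map_smul, Pi.smul_apply, smul_eq_mul]

theorem value_eq_of_eventually {h : History A B} {v : ℝ} {K : ℕ}
    (hv : ∀ k ≥ K, (step π φ ^ k) (stagePayoff G π φ) h = v) : value G π φ h = v := by
  have ht : Tendsto (fun k => (step π φ ^ k) (stagePayoff G π φ) h) atTop (nhds v) :=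
    tendsto_const_nhds.congr' ((eventually_ge_atTop K).mono fun k hk => (hv k hk).symm)
  have hc := ht.cesaro
  unfold value
  simp only [expectedAveragePayoff_eq]
  exact hc.liminf_eq

theorem value_le_of_forall {h : History A B} {v : ℝ}
    (hv : ∀ k, (step π φ ^ k) (stagePayoff G π φ) h ≤ v) : value G π φ h ≤ v := by
  have hnn : ∀ k, 0 ≤ (step π φ ^ k) (stagePayoff G π φ) h := fun k => by
    rw [← step_pow_const (π := π) (φ := φ) k 0 h]
    exact step_pow_mono fun h' _ => stagePayoff_nonneg h'
  refine liminf_le_of_le ?_ fun b hb => ?_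
  · refine isBoundedUnder_of ⟨0, fun s => ?_⟩
    rw [expectedAveragePayoff_eq]
    exact mul_nonneg (by positivity) (Finset.sum_nonneg fun k _ => hnn k)
  · obtain ⟨s, hbs, hs⟩ := (hb.and (eventually_gt_atTop 0)).exists
    refine hbs.trans ?_
    rw [expectedAveragePayoff_eq]
    have hs' : (0 : ℝ) < s := by exact_mod_cast hs
    rw [inv_mul_le_iff₀ hs']
    calc _ ≤ ∑ _k ∈ Finset.range s, v := Finset.sum_le_sum fun k _ => hv k
      _ = s * v := by simp

end Transition

/-! ### Probabilities of events after finitely many stages -/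

section Probability

variable [Fintype A] [Fintype B] {π : AliceStrategy A B} {φ : BobStrategy A B}

/-- The probability that the history after the first `n` stages lies in `S`. -/
noncomputable def histProb (π : AliceStrategy A B) (φ : BobStrategy A B) (n : ℕ)
    (S : Set (History A B)) : ℝ :=
  (step π φ ^ n) (S.indicator 1) []

theorem histProb_nonneg (n : ℕ) (S : Set (History A B)) : 0 ≤ histProb π φ n S := by
  rw [← step_pow_const (π := π) (φ := φ) n 0 []]
  exact step_pow_mono fun h _ => Set.indicator_nonneg (fun _ _ => zero_le_one) h

theorem histProb_mono {n : ℕ} {S S' : Set (History A B)}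
    (hSS : ∀ h, h.length = n → h ∈ S → h ∈ S') : histProb π φ n S ≤ histProb π φ n S' := by
  classical
  refine step_pow_mono fun h hh => ?_
  have := hSS h (by simpa using hh)
  by_cases h1 : h ∈ S
  · simp [h1, this h1]
  · rw [Set.indicator_of_notMem h1]
    exact Set.indicator_nonneg (fun _ _ => zero_le_one) h

/-- The probability of an event that persists under continuation increases over time. -/
theorem monotone_histProb {S : Set (History A B)} (hS : ∀ h ∈ S, ∀ p, p :: h ∈ S) :
    Monotone fun n => histProb π φ n S := by
  refine monotone_nat_of_le_succ fun n => ?_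
  simp only [histProb, step_pow_succ]
  refine step_pow_mono fun h _ => ?_
  by_cases hh : h ∈ S
  · rw [step_const_of_forall (c := 1) fun a b => Set.indicator_of_mem (hS h hh _) _]
    simp [hh]
  · rw [Set.indicator_of_notMem hh, ← step_pow_const (π := π) (φ := φ) 1 0 h, pow_one]
    exact step_mono fun a b => Set.indicator_nonneg (fun _ _ => zero_le_one) _

/-- The probability of an event that is inherited by initial segments decreases over time. -/
theorem antitone_histProb {S : Set (History A B)} (hS : ∀ h p, p :: h ∈ S → h ∈ S) :
    Antitone fun n => histProb π φ n S := by
  refine antitone_nat_of_succ_le fun n => ?_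
  simp only [histProb, step_pow_succ]
  refine step_pow_mono fun h _ => ?_
  by_cases hh : h ∈ S
  · rw [Set.indicator_of_mem hh, Pi.one_apply, ← step_pow_const (π := π) (φ := φ) 1 1 h, pow_one]
    exact step_mono fun a b => Set.indicator_le_self' (fun _ _ => zero_le_one) _
  · rw [step_const_of_forall (c := 0) fun a b =>
      Set.indicator_of_notMem (fun h' => hh (hS _ _ h')) _]
    simp [hh]

/-- An event that depends only on the first `k` stages keeps its probability from stage `k` on. -/
theorem histProb_drop {k n : ℕ} (hkn : k ≤ n) (S : Set (History A B)) :
    histProb π φ n {h | h.drop (h.length - k) ∈ S} = histProb π φ k S := by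
  induction n, hkn using Nat.le_induction with
  | base =>
    refine step_pow_congr fun h hh => ?_
    have : h.length = k := by simpa using hh
    have hdrop : h.drop (h.length - k) = h := by rw [this, Nat.sub_self, List.drop_zero]
    exact Set.indicator_eq_indicator (by rw [Set.mem_ofPred_eq, hdrop]) rfl
  | succ n hkn ih =>
    rw [← ih, histProb, histProb, step_pow_succ]
    refine step_pow_congr fun h hh => step_const_of_forall fun a b => ?_
    have hk : k ≤ h.length := by simp at hh; omega
    have hdrop : ((a, b) :: h).drop (((a, b) :: h).length - k) = h.drop (h.length - k) := by
      rw [List.length_cons, Nat.succ_sub hk, List.drop_succ_cons]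
    exact Set.indicator_eq_indicator (by rw [Set.mem_ofPred_eq, hdrop]; rfl) rfl

end Probability

/-! ### Runs of a constant action -/

/-- Alice has taken action `a` at every stage of `h` with index at least `m` (stages are counted
from `0`). This holds trivially if `h` has at most `m` stages. -/
def ConstSince (a : A) (m : ℕ) (h : History A B) : Prop :=
  ∀ p ∈ h.take (h.length - m), p.1 = a

theorem constSince_cons {a : A} {m : ℕ} {p : A × B} {h : History A B} (hm : m ≤ h.length) :
    ConstSince a m (p :: h) ↔ p.1 = a ∧ ConstSince a m h := by
  simp [ConstSince, Nat.succ_sub hm]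

theorem constSince_of_length_le {a : A} {m : ℕ} {h : History A B} (hm : h.length ≤ m) :
    ConstSince a m h := by
  simp [ConstSince, Nat.sub_eq_zero_of_le hm]

theorem ConstSince.tail {a : A} {m : ℕ} {p : A × B} {h : History A B}
    (hc : ConstSince a m (p :: h)) : ConstSince a m h := by
  rcases le_total m h.length with hm | hm
  · exact ((constSince_cons hm).1 hc).2
  · exact constSince_of_length_le hm

theorem ConstSince.suffix {a : A} {m : ℕ} {h h' : History A B} (hc : ConstSince a m h)
    (hs : h' <:+ h) : ConstSince a m h' := by
  obtain ⟨l, rfl⟩ := hs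
  induction l with
  | nil => exact hc
  | cons p l ih => exact ih hc.tail

theorem ConstSince.mono {a : A} {m m' : ℕ} {h : History A B} (hc : ConstSince a m h)
    (hm : m ≤ m') : ConstSince a m' h := fun p hp =>
  hc p ((List.take_prefix_take_left (Nat.sub_le_sub_left hm _)).subset hp)

/-! ### The triggering event -/

/-- Some run of `a` that started at a stage `m` in `I` has lasted until now, for at least `T m`
stages. -/
def LongRun (a : A) (T : ℕ → ℕ) (I : Set ℕ) (h : History A B) : Prop :=
  ∃ m ∈ I, m + T m ≤ h.length ∧ ConstSince a m h

/-- At some time in the past or now, a long run of `a` was in progress. -/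
def Triggered (a : A) (T : ℕ → ℕ) (I : Set ℕ) (h : History A B) : Prop :=
  ∃ h', h' <:+ h ∧ LongRun a T I h'

theorem Triggered.cons {a : A} {T : ℕ → ℕ} {I : Set ℕ} {h : History A B}
    (ht : Triggered a T I h) (p : A × B) : Triggered a T I (p :: h) := by
  obtain ⟨h', hs, hl⟩ := ht
  exact ⟨h', hs.trans (List.suffix_cons p h), hl⟩

/-! ### The probability of a trigger -/

section Runs

variable [Fintype A] [Fintype B] {π : AliceStrategy A B} {φ : BobStrategy A B}

theorem antitone_histProb_constSince (a : A) (m : ℕ) :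
    Antitone fun n => histProb π φ n {h | ConstSince a m h} :=
  antitone_histProb fun _ _ => ConstSince.tail

theorem sum_histProb_constSince_le (π : AliceStrategy A B) (φ : BobStrategy A B) (m : ℕ) :
    ∑ a, histProb π φ (m + 1) {h | ConstSince a m h} ≤ 1 := by
  classical
  simp only [histProb]
  rw [← Finset.sum_apply, ← map_sum, ← step_pow_const (π := π) (φ := φ) (m + 1) 1 []]
  refine step_pow_mono fun h hh => ?_
  obtain _ | ⟨p, h⟩ := h
  · simp at hh
  have hm : h.length = m := by simpa using hh
  have hiff : ∀ a, ConstSince a m (p :: h) ↔ p.1 = a := fun a => by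
    rw [constSince_cons hm.ge]
    exact and_iff_left (constSince_of_length_le hm.le)
  simp [Finset.sum_apply, Set.indicator, hiff]

/-- By the disjointness of the events "`a` is played forever", some action has the property that
Alice settles on it with probability at most `1 / |A|`. -/
theorem exists_action_rarely_constSince [Nonempty A] (π : AliceStrategy A B)
    (φ : BobStrategy A B) :
    ∃ a : A, ∀ m, ∀ ε > 0, ∃ n,
      histProb π φ n {h | ConstSince a m h} < 1 / Fintype.card A + ε := by
  by_contra! hcon
  choose m ε hε hm using hcon
  set M := Finset.univ.sup m
  have hlt : ∀ a, (1 : ℝ) / Fintype.card A < histProb π φ (M + 1) {h | ConstSince a M h} :=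
    fun a => calc
      (1 : ℝ) / Fintype.card A < 1 / Fintype.card A + ε a := lt_add_of_pos_right _ (hε a)
      _ ≤ histProb π φ (M + 1) {h | ConstSince a (m a) h} := hm a _
      _ ≤ _ := histProb_mono fun h _ hc =>
        ConstSince.mono hc (Finset.le_sup (f := m) (Finset.mem_univ a))
  have h1 := Finset.sum_lt_sum_of_nonempty Finset.univ_nonempty fun a _ => hlt a
  have h2 : ∑ _a : A, (1 : ℝ) / Fintype.card A = 1 := by
    simp
  linarith [sum_histProb_constSince_le π φ M]

/-- A union bound: a run of `a` from `m < M` of length `T m` either breaks off later, or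
continues, and then it is in particular a run from `M`. -/
theorem histProb_triggered_le {a : A} {T : ℕ → ℕ} {M n : ℕ} (hn : ∀ m < M, m + T m ≤ n) :
    histProb π φ n {h | Triggered a T (Set.Iio M) h} ≤
      ∑ m ∈ Finset.range M, (histProb π φ (m + T m) {h | ConstSince a m h}
        - histProb π φ n {h | ConstSince a m h})
      + histProb π φ n {h | ConstSince a M h} := by
  classical
  have hpt : ∀ h : History A B, h.length = ([] : History A B).length + n →
      Set.indicator {h | Triggered a T (Set.Iio M) h} (1 : History A B → ℝ) h ≤
      (∑ m ∈ Finset.range M,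
        (Set.indicator {h : History A B | ConstSince a m (h.drop (h.length - (m + T m)))} 1
          - Set.indicator {h | ConstSince a m h} 1)
        + Set.indicator {h | ConstSince a M h} 1 : History A B → ℝ) h := by
    intro h hh
    have hlen : h.length = n := by simpa using hh
    simp only [Pi.add_apply, Finset.sum_apply, Pi.sub_apply]
    set d : ℕ → ℝ := fun m =>
      Set.indicator {h : History A B | ConstSince a m (h.drop (h.length - (m + T m)))} 1 h
        - Set.indicator {h : History A B | ConstSince a m h} 1 h with hd
    have hd0 : ∀ m, 0 ≤ d m := by
      intro m
      by_cases hc : ConstSince a m h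
      · simp [hd, hc, hc.suffix (List.drop_suffix _ h)]
      · simp only [hd, Set.indicator, Set.mem_ofPred_eq, hc, if_false, sub_zero]
        split_ifs <;> simp
    have hM0 : 0 ≤ Set.indicator {h : History A B | ConstSince a M h} (1 : History A B → ℝ) h :=
      Set.indicator_nonneg (fun _ _ => zero_le_one) h
    by_cases ht : Triggered a T (Set.Iio M) h
    · rw [Set.indicator_of_mem (show h ∈ {h | Triggered a T (Set.Iio M) h} from ht),
        Pi.one_apply]
      obtain ⟨h', hs, m, hm, hmT, hc'⟩ := ht
      have hm' : m < M := hm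
      by_cases hc : ConstSince a m h
      · have : Set.indicator {h : History A B | ConstSince a M h} (1 : History A B → ℝ) h = 1 := by
          simp [hc.mono hm'.le]
        rw [this]
        linarith [Finset.sum_nonneg (s := Finset.range M) fun m _ => hd0 m]
      · have hcd : ConstSince a m (h.drop (h.length - (m + T m))) := by
          refine hc'.suffix (List.suffix_of_suffix_length_le (List.drop_suffix _ h) hs ?_)
          have := hn m hm'
          rw [List.length_drop]
          omega
        have hd1 : d m = 1 := by simp [hd, hc, hcd]
        have := Finset.single_le_sum (fun m _ => hd0 m) (Finset.mem_range.2 hm')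
        linarith
    · rw [Set.indicator_of_notMem (show h ∉ {h | Triggered a T (Set.Iio M) h} from ht)]
      exact add_nonneg (Finset.sum_nonneg fun m _ => hd0 m) hM0
  refine (step_pow_mono hpt).trans (le_of_eq ?_)
  rw [map_add, map_sum, Pi.add_apply, Finset.sum_apply]
  congr 1
  refine Finset.sum_congr rfl fun m hm => ?_
  rw [map_sub, Pi.sub_apply,
    ← histProb_drop (hn m (Finset.mem_range.1 hm)) {h | ConstSince a m h}]
  rfl

/-- Patience thresholds can be chosen so that long runs of a rarely kept action are unlikely at
any time. -/
theorem exists_thresholds {a : A} {q δ : ℝ} (hδ : 0 < δ)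
    (ha : ∀ m, ∀ ε > 0, ∃ n, histProb π φ n {h | ConstSince a m h} < q + ε) :
    ∃ T : ℕ → ℕ, (∀ m, 0 < T m) ∧
      ∀ n, histProb π φ n {h | Triggered a T Set.univ h} ≤ q + δ := by
  have hT : ∀ m, ∃ t, 0 < t ∧ ∀ n, histProb π φ (m + t) {h | ConstSince a m h} ≤
      histProb π φ n {h | ConstSince a m h} + δ / 4 * (1 / 2) ^ m := by
    intro m
    have hbdd : BddBelow (Set.range fun n => histProb π φ n {h | ConstSince a m h}) :=
      ⟨0, by rintro _ ⟨n, rfl⟩; exact histProb_nonneg n _⟩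
    obtain ⟨t, ht⟩ := exists_lt_of_ciInf_lt (lt_add_of_pos_right
      (⨅ n, histProb π φ n {h | ConstSince a m h})
      (show 0 < δ / 4 * (1 / 2 : ℝ) ^ m by positivity))
    refine ⟨t + 1, t.succ_pos, fun n => ?_⟩
    have h1 := antitone_histProb_constSince (π := π) (φ := φ) a m
      (show t ≤ m + (t + 1) by omega)
    have h2 := ciInf_le hbdd n
    dsimp only at h1
    linarith
  choose T hT0 hT using hT
  refine ⟨T, hT0, fun n => ?_⟩
  obtain ⟨n₀, hn₀⟩ := ha n (δ / 2) (by positivity)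
  -- A horizon beyond `n₀` by which all runs started before stage `n` can have become long.
  set n' := n + n₀ + (Finset.range n).sup fun m => m + T m
  have hn' : ∀ m < n, m + T m ≤ n' := fun m hm =>
    (Finset.le_sup (f := fun m => m + T m) (Finset.mem_range.2 hm)).trans (by omega)
  have htail : histProb π φ n' {h | ConstSince a n h} ≤ q + δ / 2 :=
    (antitone_histProb_constSince a n (show n₀ ≤ n' by omega)).trans hn₀.le
  have hsum : ∑ m ∈ Finset.range n, (histProb π φ (m + T m) {h | ConstSince a m h}
      - histProb π φ n' {h | ConstSince a m h}) ≤ δ / 2 := calc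
    _ ≤ ∑ m ∈ Finset.range n, δ / 4 * (1 / 2 : ℝ) ^ m :=
      Finset.sum_le_sum fun m _ => by linarith [hT m n']
    _ = δ / 4 * ∑ m ∈ Finset.range n, (1 / 2 : ℝ) ^ m := by rw [Finset.mul_sum]
    _ ≤ δ / 4 * 2 := mul_le_mul_of_nonneg_left (sum_geometric_two_le n) (by positivity)
    _ = δ / 2 := by ring
  calc histProb π φ n {h | Triggered a T Set.univ h}
      ≤ histProb π φ n {h | Triggered a T (Set.Iio n) h} := by
        refine histProb_mono fun h hh => ?_
        rintro ⟨h', hs, m, -, hm, hc⟩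
        have := hs.length_le
        have := hT0 m
        exact ⟨h', hs, m, show m < n by omega, hm, hc⟩
    _ ≤ histProb π φ n' {h | Triggered a T (Set.Iio n) h} :=
        monotone_histProb (S := {h | Triggered a T (Set.Iio n) h})
          (fun h hh p => Triggered.cons hh p) (show n ≤ n' by omega)
    _ ≤ _ := histProb_triggered_le hn'
    _ ≤ q + δ := by linarith

end Runs

/-! ### Bob's trigger strategy in the coordination game -/

section Coordination

variable {N : ℕ} [NeZero N]

/-- Bob rewards Alice by matching `a` while she is on a long run of `a`, and mixes uniformly
otherwise. -/
noncomputable def triggerStrategy (a : Fin N) (T : ℕ → ℕ) : BobStrategy (Fin N) (Fin N) :=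
  open Classical in
  fun h => if LongRun a T Set.univ h then PMF.pure a else PMF.uniformOfFintype (Fin N)

variable {a : Fin N} {T : ℕ → ℕ}

theorem value_trigger_self (h : History (Fin N) (Fin N)) :
    value (coordinationGame N) (fixedAction a) (triggerStrategy a T) h = 1 := by
  refine value_eq_of_eventually (K := T h.length) fun k hk =>
    step_pow_fixedAction_eq fun l hl hla => ?_
  have hrun : LongRun a T Set.univ (l ++ h) := by
    refine ⟨h.length, trivial, by simp; omega, fun p hp => hla p ?_⟩
    simpa using hp
  rw [stagePayoff_fixedAction]
  simp [triggerStrategy, hrun, coordinationGame]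

theorem value_trigger_of_ne (hT : ∀ m, 0 < T m) {c : Fin N} (hc : c ≠ a)
    (h : History (Fin N) (Fin N)) :
    value (coordinationGame N) (fixedAction c) (triggerStrategy a T) h = 1 / N := by
  refine value_eq_of_eventually (K := 1) fun k hk =>
    step_pow_fixedAction_eq fun l hl hlc => ?_
  obtain _ | ⟨p, l⟩ := l
  · simp at hl; omega
  have hrun : ¬ LongRun a T Set.univ (p :: (l ++ h)) := by
    rintro ⟨m, -, hm, hcs⟩
    have hm' : m ≤ (l ++ h).length := by
      have := hT m
      simp only [List.length_cons] at hm
      omega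
    exact hc ((hlc p (by simp)).symm.trans ((constSince_cons hm').1 hcs).1)
  rw [stagePayoff_fixedAction]
  simp [triggerStrategy, hrun, coordinationGame]

/-- Alice earns `1 / N` per stage until the trigger, and at most `1` afterwards. As long as the
trigger has not occurred, Bob's play is indistinguishable from uniform play. -/
theorem value_trigger_le {π : AliceStrategy (Fin N) (Fin N)} {q : ℝ}
    (hq : ∀ n, histProb π (fun _ => PMF.uniformOfFintype (Fin N)) n
      {h | Triggered a T Set.univ h} ≤ q) :
    value (coordinationGame N) π (triggerStrategy a T) [] ≤ 1 / N + q := by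
  classical
  refine value_le_of_forall fun k => ?_
  set S : Set (History (Fin N) (Fin N)) := {h | Triggered a T Set.univ h}
  have hrun : ∀ h ∉ S, ¬ LongRun a T Set.univ h := fun h hh hl => hh ⟨h, List.suffix_rfl, hl⟩
  have hpt : ∀ h, stagePayoff (coordinationGame N) π (triggerStrategy a T) h ≤
      ((fun _ => (1 : ℝ) / N + 1) - Sᶜ.indicator 1 : History (Fin N) (Fin N) → ℝ) h := by
    intro h
    by_cases hh : h ∈ S
    · have := stagePayoff_le_one (G := coordinationGame N) (π := π)
        (φ := triggerStrategy a T) h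
      have h0 : (0 : ℝ) ≤ 1 / N := by positivity
      simp only [Pi.sub_apply, Set.indicator, Set.mem_compl_iff, hh, not_true_eq_false, if_false]
      linarith
    · refine le_of_eq ?_
      simp [stagePayoff, triggerStrategy, hrun h hh, coordinationGame, hh,
        ← Finset.sum_mul, sum_toReal_eq_one]
  have hcompl : ∀ (ψ : BobStrategy (Fin N) (Fin N)),
      (step π ψ ^ k) (Sᶜ.indicator 1) [] = 1 - histProb π ψ k S := by
    intro ψ
    have : (Sᶜ.indicator 1 : History (Fin N) (Fin N) → ℝ) = (fun _ => 1) - S.indicator 1 :=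
      Set.indicator_compl S 1
    rw [this, map_sub, Pi.sub_apply, step_pow_const, histProb]
  have hagree := step_pow_eq_of_agree (π := π) (φ := triggerStrategy a T)
    (ψ := fun _ => PMF.uniformOfFintype (Fin N)) (S := S) (fun h hh p => Triggered.cons hh p)
    (fun h hh => by simp [triggerStrategy, hrun h hh]) k (f := Sᶜ.indicator 1)
    (fun h hh => by simp [hh])
  calc _ ≤ (step π (triggerStrategy a T) ^ k) ((fun _ => (1 : ℝ) / N + 1) - Sᶜ.indicator 1) [] :=
        step_pow_mono fun h _ => hpt h
    _ = 1 / N + histProb π (fun _ => PMF.uniformOfFintype (Fin N)) k S := by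
        rw [map_sub, Pi.sub_apply, step_pow_const, hagree, hcompl]
        ring
    _ ≤ 1 / N + q := by linarith [hq k]

end Coordination

theorem theorem1 (N : ℕ) (hN : 3 ≤ N) :
    ∃ (G : RepeatedGame (Fin N) (Fin N)) (E : Set (AliceStrategy (Fin N) (Fin N))),
      G = coordinationGame N ∧ E = fixedActionExperts (Fin N) (Fin N) ∧
      E.Finite ∧ E.Nonempty ∧
      ∀ (𝒜 : LearningAlgorithm (Fin N) (Fin N)) (δ : ℝ), 0 < δ → δ < ((N : ℝ) - 2) / N →
        ∃ φ : BobStrategy (Fin N) (Fin N),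
          adaptiveRegret G E (𝒜 G E) φ ≥ (1 / 2) * (((N : ℝ) - 2) / N - δ) ^ 2 ∧
          IsOpenEnded G E φ := by
  have : NeZero N := ⟨by omega⟩
  refine ⟨coordinationGame N, fixedActionExperts (Fin N) (Fin N), rfl, rfl,
    Set.finite_range _, Set.range_nonempty _, fun 𝒜 δ hδ hδN => ?_⟩
  set π := 𝒜 (coordinationGame N) (fixedActionExperts (Fin N) (Fin N))
  obtain ⟨a, ha⟩ := exists_action_rarely_constSince π fun _ => PMF.uniformOfFintype (Fin N)
  obtain ⟨T, hT, hTq⟩ := exists_thresholds hδ ha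
  refine ⟨triggerStrategy a T, ?_, ?_⟩
  · have hval := value_trigger_le hTq
    have hsup : 1 ≤ sSup ((fun e => value (coordinationGame N) e (triggerStrategy a T) []) ''
        fixedActionExperts (Fin N) (Fin N)) := by
      refine le_csSup ((Set.finite_range _).image _).bddAbove ?_
      exact ⟨fixedAction a, ⟨a, rfl⟩, value_trigger_self []⟩
    have hN0 : (0 : ℝ) < N := by
      exact_mod_cast Nat.pos_of_ne_zero (NeZero.ne N)
    rw [Fintype.card_fin] at hval
    have hdiv : ((N : ℝ) - 2) / N = 1 - 1 / N - 1 / N := by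
      field_simp
      ring
    have hinv : (0 : ℝ) < 1 / N := by positivity
    rw [hdiv] at hδN ⊢
    unfold adaptiveRegret
    -- The regret is at least `c = (N - 2) / N - δ`, and `c ^ 2 / 2 ≤ c` because `0 ≤ c ≤ 1`.
    nlinarith
  · rintro _ ⟨c, rfl⟩
    by_cases hc : c = a
    · exact ⟨1, fun h => hc ▸ value_trigger_self h⟩
    · exact ⟨1 / N, fun h => value_trigger_of_ne hT hc h⟩
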